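/- Let $(R,\mathfrak m)$ be a complete regular local ring, let $R^+$ be its absolute integral closure (the integral closure of $R$ in an algebraic closure of its fraction field), let $f\in R$, and let $B$ be a big Cohen--Macaulay $R^+$-algebra, i.e. an $R^+$-algebra on which every system of parameters of $R$ is a regular sequence. Assume that $R$ has prime characteristic, or that $B/JB$ is $\mathfrak m$-adically separated for every ideal $J$ of $R$ (this holds, for example, if $B$ is $\mathfrak m$-adically complete). For real $t\ge 0$ put $$(fR^+)^{>t}=\{g\in R^+ : g^n\in f^mR^+ \text{ for some integers } m\ge 0,\ n\ge 1 \text{ with } m/n>t\},$$ let $(fR^+)^{>t}B$ be the ideal of $B$ generated by its image, and let $\tau_B(f^t)\subseteq R$ be the ideal generated by $\{\varphi(x) : x\in (fR^+)^{>t}B,\ \varphi\in\operatorname{Hom}_R(B,R)\}$. A real number $\alpha\ge 0$ is a $B$-jumping number of $f$ if $\tau_B(f^\alpha)\ne\tau_B(f^{\alpha-\varepsilon})$ for all $0<\varepsilon\le\alpha$ (so $0$ is a jumping number by convention). For an ideal $J$ of $R$ the $B$-threshold of $f$ is $$c_B^J(f)=\inf\{t\ge 0 : (fR^+)^{>t}\subseteq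 JB\}\in[0,\infty],$$ where $(fR^+)^{>t}\subseteq JB$ means that the image of $(fR^+)^{>t}$ in $B$ lies in $JB$, and $\inf\emptyset=\infty$. Then the set of $B$-jumping numbers of $f$ equals the set of all finite $B$-thresholds $c_B^J(f)$, where $J$ ranges over the ideals of $R$. -/

import Mathlib

open scoped NNReal ENNReal

noncomputable section

namespace BCM

/-- A system of parameters of a Noetherian local ring `R`: a list of `dim R` elements generating an
ideal whose radical is the maximal ideal. -/
structure IsSystemOfParameters (R : Type*) [CommRing R] [IsLocalRing R] (rs : List R) : Prop where
  length_eq : (rs.length : WithBot ℕ∞) = ringKrullDim R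
  radical_eq : (Ideal.ofList rs).radical = IsLocalRing.maximalIdeal R

/-- An algebra `B` over a Noetherian local ring `R` is (balanced) big Cohen-Macaulay if every
system of parameters of `R` is a regular sequence on `B`
(`RingTheory.Sequence.IsRegular` includes that the parameters do not generate the unit ideal
of `B`). -/
def IsBigCohenMacaulay (R B : Type*) [CommRing R] [IsLocalRing R] [CommRing B] [Algebra R B] :
    Prop :=
  ∀ rs : List R, IsSystemOfParameters R rs → RingTheory.Sequence.IsRegular B rs

/-- The absolute integral closure `R⁺` of a domain `R`: the integral closure of `R` in an algebraic
closure `K` of its field of fractions. The field `K` is an algebraic closure of `Frac R` exactly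
when it is algebraically closed, contains `R`, and is algebraic over `R`. -/
abbrev AbsIntegralClosure (R K : Type*) [CommRing R] [Field K] [Algebra R K] [FaithfulSMul R K]
    [IsAlgClosed K] [Algebra.IsAlgebraic R K] : Subalgebra R K :=
  integralClosure R K

/-- `(f S)^{> t} = {g ∈ S ∣ g ^ n ∈ f ^ m S for some m / n > t}`. -/
def powGT {R : Type*} (S : Type*) [CommRing R] [CommRing S] [Algebra R S] (f : R) (t : ℝ≥0) :
    Set S :=
  {g | ∃ m n : ℕ, 0 < n ∧ t < (m : ℝ≥0) / (n : ℝ≥0) ∧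
    g ^ n ∈ Ideal.span {algebraMap R S f ^ m}}

section

variable {R : Type*} (S B : Type*) [CommRing R] [CommRing S] [CommRing B]
  [Algebra R S] [Algebra R B] [Algebra S B]

/-- The ideal `(f S)^{> t} B` of `B`, for an `S`-algebra `B` (used with `S = R⁺`). -/
def powGTIdeal (f : R) (t : ℝ≥0) : Ideal B :=
  Ideal.span (algebraMap S B '' powGT S f t)

/-- The `B`-threshold `c^J_B(f) = inf {t ≥ 0 ∣ (f S)^{> t} ⊆ J B}` (used with `S = R⁺`). It takes
values in `[0, ∞]`; it is `∞` if there is no such `t`. -/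
def threshold (J : Ideal R) (f : R) : ℝ≥0∞ :=
  sInf ((fun t : ℝ≥0 => (t : ℝ≥0∞)) ''
    {t : ℝ≥0 | ∀ g ∈ powGT S f t, algebraMap S B g ∈ J.map (algebraMap R B)})

/-- The test ideal `τ_B(f ^ t)`, generated by the `φ x` with `x ∈ (f S)^{> t} B` and
`φ ∈ Hom_R(B, R)` (used with `S = R⁺`). -/
def testIdeal (f : R) (t : ℝ≥0) : Ideal R :=
  Ideal.span {r : R | ∃ x ∈ powGTIdeal S B f t, ∃ φ : B →ₗ[R] R, φ x = r}

/-- `α ≥ 0` is a `B`-jumping number of `f` if `τ_B(f ^ α) ≠ τ_B(f ^ (α - ε))` for all `ε > 0` for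
which the exponent `α - ε` is still nonnegative. In particular `0` is a jumping number. -/
def IsJumpingNumber (f : R) (α : ℝ≥0) : Prop :=
  ∀ ε : ℝ≥0, 0 < ε → ε ≤ α → testIdeal S B f α ≠ testIdeal S B f (α - ε)

end

end BCM

end

/-! Everything rests on the equivalence `threshold S B J f ≤ t ↔ testIdeal S B f t ≤ J`, from which
the theorem is formal (`isJumpingNumber_iff_exists_threshold_eq`). Its nontrivial half asks that `(f
R⁺)^{> t}` lie in `τ_B(f ^ t) B`, so ideals `J B` must be detected by functionals `B → R`. Let `Q n`
be generated by the powers `x i ^ (n + 1)` of regular parameters. As `B` is big Cohen-Macaulay, a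
lift `T` to `B` of a basis of `B / m B` is bijective modulo every `Q n`; since `R` is complete,
coordinates are functionals `B → R`. If all `φ b` lie in `J`, then `b ∈ (J + m ^ n) B` for all `n`
(`mem_sup_pow_smul_top_of_forall_apply_mem`). Separatedness then gives `b ∈ J B`. In characteristic
`p` one reduces to `b = f ^ (a / p ^ e)`, uses Frobenius and Krull's theorem to get `f ^ a ∈ J ^ [p
^ e]` in `R`, and takes roots in `R⁺`. -/

namespace BCM

/-! ### Coordinate functionals on big Cohen-Macaulay modules -/

section Coordinates

open IsLocalRing

variable {R F M ι : Type*} [CommRing R] [AddCommGroup F] [Module R F] [AddCommGroup M] [Module R M]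

lemma mem_sup_span_singleton_smul_top {I : Ideal R} {y : R} {v : M} :
    v ∈ (I ⊔ Ideal.span {y}) • (⊤ : Submodule R M) ↔
      ∃ p ∈ I • (⊤ : Submodule R M), ∃ w : M, v = p + y • w := by
  rw [Submodule.sup_smul, Submodule.mem_sup]
  refine exists_congr fun p => and_congr_right fun _ => ?_
  rw [Submodule.ideal_span_singleton_smul]
  constructor
  · rintro ⟨z, hz, rfl⟩
    obtain ⟨w, -, rfl⟩ := (Submodule.mem_smul_pointwise_iff_exists _ _ _).1 hz
    exact ⟨w, rfl⟩
  · rintro ⟨w, rfl⟩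
    exact ⟨y • w, Submodule.smul_mem_pointwise_smul _ _ _ trivial, rfl⟩

lemma map_mem_smul_top (T : F →ₗ[R] M) {I : Ideal R} {v : F}
    (hv : v ∈ I • (⊤ : Submodule R F)) : T v ∈ I • (⊤ : Submodule R M) := by
  have h := Submodule.mem_map_of_mem (f := T) hv
  rw [Submodule.map_smul''] at h
  exact Submodule.smul_mono le_rfl le_top h

/-- If `F / I F → M / I M` is injective for `I + (x ^ c)` and for `I + (x)`, and `x ^ c` is a
nonzerodivisor on `M / I M`, then the map is injective for `I + (x ^ (c + 1))`. -/
lemma reflects_smul_top_pow_succ (T : F →ₗ[R] M) (I : Ideal R) (x : R) (c : ℕ)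
    (hreg : ∀ m : M, x ^ c • m ∈ I • (⊤ : Submodule R M) → m ∈ I • (⊤ : Submodule R M))
    (h1 : ∀ v, T v ∈ (I ⊔ Ideal.span {x}) • (⊤ : Submodule R M) →
      v ∈ (I ⊔ Ideal.span {x}) • (⊤ : Submodule R F))
    (hc : ∀ v, T v ∈ (I ⊔ Ideal.span {x ^ c}) • (⊤ : Submodule R M) →
      v ∈ (I ⊔ Ideal.span {x ^ c}) • (⊤ : Submodule R F))
    (v : F) (hv : T v ∈ (I ⊔ Ideal.span {x ^ (c + 1)}) • (⊤ : Submodule R M)) :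
    v ∈ (I ⊔ Ideal.span {x ^ (c + 1)}) • (⊤ : Submodule R F) := by
  simp only [mem_sup_span_singleton_smul_top] at *
  obtain ⟨p, hp, m, hm⟩ := hv
  obtain ⟨q, hq, w, rfl⟩ := hc v ⟨p, hp, x • m, by rw [hm, pow_succ, mul_smul]⟩
  -- Multiplied by `x ^ c`, this difference is `p - T q ∈ I M`, and `x ^ c` cancels.
  have key : T w - x • m ∈ I • (⊤ : Submodule R M) := by
    refine hreg _ ?_
    have : x ^ c • (T w - x • m) = p - T q := by
      rw [map_add, map_smul, pow_succ, mul_smul] at hm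
      rw [smul_sub, sub_eq_sub_iff_add_eq_add, ← hm]
      abel
    rw [this]
    exact sub_mem hp (map_mem_smul_top T hq)
  obtain ⟨r, hr, u, rfl⟩ := h1 w ⟨_, key, m, by abel⟩
  exact ⟨q + x ^ c • r, add_mem hq (Submodule.smul_mem _ _ hr), u, by
    rw [smul_add, pow_succ, mul_smul, add_assoc]⟩

/-- The ideal generated by the powers `x i ^ (e i + 1)`. -/
def powIdeal {d : ℕ} (x : Fin d → R) (e : Fin d → ℕ) : Ideal R :=
  Ideal.span (Set.range fun i => x i ^ (e i + 1))

/-- The ideal generated by the powers `x j ^ (e j + 1)` with `j ≠ i`. -/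
def powIdealErase {d : ℕ} (x : Fin d → R) (e : Fin d → ℕ) (i : Fin d) : Ideal R :=
  Ideal.span ((fun j => x j ^ (e j + 1)) '' {i}ᶜ)

lemma powIdeal_update {d : ℕ} (x : Fin d → R) (e : Fin d → ℕ) (i : Fin d) (c : ℕ) :
    powIdeal x (Function.update e i c) = powIdealErase x e i ⊔ Ideal.span {x i ^ (c + 1)} := by
  rw [powIdeal, powIdealErase, ← Ideal.span_union, ← Set.image_univ, ← Set.compl_union_self {i},
    Set.image_union, Set.image_singleton, Function.update_self]
  congr 2
  refine Set.image_congr fun j hj => ?_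
  rw [Function.update_of_ne hj]

/-- Induction on the sum of the exponents: an entry `e i = c + 1` stands for `x i ^ (c + 2)`, and
the cases needed are `x i` and `x i ^ (c + 1)`, i.e. entries `0` and `c`. -/
lemma powIdeal_reflects_smul_top {d : ℕ} (x : Fin d → R) (T : F →ₗ[R] M)
    (hreg : ∀ e i c (m : M), x i ^ (c + 1) • m ∈ powIdealErase x e i • (⊤ : Submodule R M) →
      m ∈ powIdealErase x e i • (⊤ : Submodule R M))
    (h0 : ∀ v, T v ∈ powIdeal x 0 • (⊤ : Submodule R M) →
      v ∈ powIdeal x 0 • (⊤ : Submodule R F)) (e : Fin d → ℕ) :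
    ∀ v, T v ∈ powIdeal x e • (⊤ : Submodule R M) → v ∈ powIdeal x e • (⊤ : Submodule R F) := by
  induction hn : ∑ i, e i using Nat.strong_induction_on generalizing e with
  | _ n ih =>
  by_cases he : e = 0
  · rwa [he]
  obtain ⟨i, hi⟩ := Function.ne_iff.1 he
  obtain ⟨c, hc⟩ := Nat.exists_eq_succ_of_ne_zero hi
  have hlt : ∀ k ≤ c, ∑ j, Function.update e i k j < n := by
    intro k hk
    rw [← hn]
    refine Finset.sum_lt_sum (fun j _ => ?_) ⟨i, Finset.mem_univ _, ?_⟩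
    · rcases eq_or_ne j i with rfl | hj
      · rw [Function.update_self]; omega
      · rw [Function.update_of_ne hj]
    · rw [Function.update_self]; omega
  have h1 := ih _ (hlt 0 (Nat.zero_le _)) _ rfl
  have h2 := ih _ (hlt c le_rfl) _ rfl
  have h3 : powIdeal x e = powIdealErase x e i ⊔ Ideal.span {x i ^ (c + 1 + 1)} := by
    rw [← powIdeal_update, ← Nat.succ_eq_add_one c, ← hc, Function.update_eq_self]
  rw [powIdeal_update] at h1 h2
  rw [zero_add, pow_one] at h1
  rw [h3]
  exact reflects_smul_top_pow_succ T _ _ _ (hreg e i c) h1 h2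

lemma apply_mem_of_mem_smul_top {I : Ideal R} {v : ι →₀ R}
    (hv : v ∈ I • (⊤ : Submodule R (ι →₀ R))) (i : ι) : v i ∈ I := by
  have := map_mem_smul_top (Finsupp.lapply i) hv
  rwa [smul_eq_mul, Ideal.mul_top] at this

lemma mem_smul_top_of_apply_mem {I : Ideal R} {v : ι →₀ R} (hv : ∀ i, v i ∈ I) :
    v ∈ I • (⊤ : Submodule R (ι →₀ R)) := by
  rw [← Finsupp.sum_single v]
  refine Submodule.sum_mem _ fun i _ => ?_
  rw [← mul_one (v i), ← smul_eq_mul, ← Finsupp.smul_single]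
  exact Submodule.smul_mem_smul (hv i) trivial

/-- A linear map from a free module whose reduction modulo the maximal ideal `I` is bijective. -/
lemma exists_lift_basis.{v} (I : Ideal R) [I.IsMaximal] (M : Type v) [AddCommGroup M] [Module R M] :
    ∃ (κ : Type v) (T : (κ →₀ R) →ₗ[R] M),
      LinearMap.range T ⊔ I • (⊤ : Submodule R M) = ⊤ ∧
      ∀ v, T v ∈ I • (⊤ : Submodule R M) → v ∈ I • (⊤ : Submodule R (κ →₀ R)) := by
  let := Ideal.Quotient.field I
  let V := M ⧸ I • (⊤ : Submodule R M)
  let b := Module.Basis.ofVectorSpace (R ⧸ I) V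
  choose β hβ using fun i => Submodule.mkQ_surjective (I • (⊤ : Submodule R M)) (b i)
  have hT : ∀ v, (I • (⊤ : Submodule R M)).mkQ (Finsupp.linearCombination R β v) =
      Finsupp.linearCombination (R ⧸ I) b
        (v.mapRange (Ideal.Quotient.mk I) (map_zero _)) := by
    intro v
    rw [Finsupp.linearCombination_apply, Finsupp.linearCombination_apply,
      Finsupp.sum_mapRange_index (by simp), map_finsuppSum]
    refine Finsupp.sum_congr fun i _ => ?_
    rw [map_smul, hβ]
    rfl
  refine ⟨_, Finsupp.linearCombination R β, ?_, fun v hv => ?_⟩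
  · rw [eq_top_iff]
    rintro m -
    obtain ⟨w, hw⟩ := Finsupp.mapRange_surjective (α := Module.Basis.ofVectorSpaceIndex (R ⧸ I) V)
      (Ideal.Quotient.mk I) (map_zero _) Ideal.Quotient.mk_surjective (b.repr (Submodule.Quotient.mk m))
    refine Submodule.mem_sup.2 ⟨_, ⟨w, rfl⟩, m - Finsupp.linearCombination R β w, ?_, by abel⟩
    refine (Submodule.Quotient.mk_eq_zero _).1 (?_ : Submodule.mkQ _ _ = 0)
    rw [map_sub, hT, hw, b.linearCombination_repr]
    exact sub_self _
  · refine mem_smul_top_of_apply_mem fun i => ?_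
    have h0 := (linearIndependent_iff.1 b.linearIndependent) _
      ((hT v).symm.trans ((Submodule.Quotient.mk_eq_zero _).2 hv))
    have := DFunLike.congr_fun h0 i
    rw [Finsupp.mapRange_apply] at this
    exact Ideal.Quotient.eq_zero_iff_mem.1 this

/-- Substitute `M = N + I M` into `I ^ n M`. No finiteness of `M` is needed, as only powers of `I`
are reached. -/
lemma sup_pow_smul_top (I : Ideal R) (N : Submodule R M)
    (h : N ⊔ I • (⊤ : Submodule R M) = ⊤) (n : ℕ) : N ⊔ I ^ n • (⊤ : Submodule R M) = ⊤ := by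
  induction n with
  | zero => simp
  | succ n ih =>
    refine top_le_iff.1 (ih.ge.trans (sup_le le_sup_left ?_))
    calc I ^ n • (⊤ : Submodule R M) = I ^ n • N ⊔ I ^ (n + 1) • (⊤ : Submodule R M) := by
          rw [pow_succ, Submodule.mul_smul, ← Submodule.smul_sup, h]
      _ ≤ _ := sup_le_sup_right Submodule.smul_le_right _

/-- The `i`-th coordinate functional of the completion of a free module. -/
lemma exists_coordinate (I : Ideal R) [IsAdicComplete I R] (T : (ι →₀ R) →ₗ[R] M)
    (Q : ℕ → Ideal R) (hanti : Antitone Q) (hQ : ∀ n, Q n ≤ I ^ n)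
    (hinj : ∀ n v, T v ∈ Q n • (⊤ : Submodule R M) → v ∈ Q n • (⊤ : Submodule R (ι →₀ R)))
    (hsurj : ∀ n, LinearMap.range T ⊔ Q n • (⊤ : Submodule R M) = ⊤) (i : ι) :
    ∃ φ : M →ₗ[R] R, ∀ n w m, m - T w ∈ Q n • (⊤ : Submodule R M) → φ m - w i ∈ I ^ n := by
  have hex : ∀ n m, ∃ w, m - T w ∈ Q n • (⊤ : Submodule R M) := by
    intro n m
    obtain ⟨_, ⟨w, rfl⟩, z, hz, h⟩ := Submodule.mem_sup.1 (hsurj n ▸ Submodule.mem_top : m ∈ _)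
    exact ⟨w, by rwa [← h, add_sub_cancel_left]⟩
  choose w hw using hex
  -- Injectivity modulo `Q n` determines the `i`-th coordinate modulo `I ^ n`, so the approximations
  -- form a Cauchy sequence.
  have huniq : ∀ n m v v', m - T v ∈ Q n • (⊤ : Submodule R M) →
      m - T v' ∈ Q n • (⊤ : Submodule R M) → v i - v' i ∈ I ^ n := by
    intro n m v v' hv hv'
    have := sub_mem hv' hv
    rw [sub_sub_sub_cancel_left, ← map_sub] at this
    exact hQ n (apply_mem_of_mem_smul_top (hinj n _ this) i)
  have hlim : ∀ m, ∃ L : R, ∀ n, w n m i - L ∈ I ^ n := by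
    intro m
    obtain ⟨L, hL⟩ := IsPrecomplete.prec (IsAdicComplete.toIsPrecomplete (I := I) (M := R))
      (f := fun n => w n m i) (fun {a b} hab => by
        rw [SModEq.sub_mem, smul_eq_mul, Ideal.mul_top]
        exact huniq a m _ _ (hw a m) (Submodule.smul_mono_left (hanti hab) (hw b m)))
    refine ⟨L, fun n => ?_⟩
    have := hL n
    rwa [SModEq.sub_mem, smul_eq_mul, Ideal.mul_top] at this
  choose L hL using hlim
  have hmain : ∀ n v m, m - T v ∈ Q n • (⊤ : Submodule R M) → L m - v i ∈ I ^ n := by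
    intro n v m hv
    have h := sub_mem (huniq n m _ _ (hw n m) hv) (hL m n)
    rwa [sub_sub_sub_cancel_left] at h
  have hzero : ∀ r : R, (∀ n, r ∈ I ^ n) → r = 0 := fun r hr =>
    IsHausdorff.haus (IsAdicComplete.toIsHausdorff (I := I) (M := R)) r fun n => by
      rw [SModEq.zero, smul_eq_mul, Ideal.mul_top]; exact hr n
  refine ⟨{ toFun := L, map_add' := fun a b => ?_, map_smul' := fun r a => ?_ }, hmain⟩
  · refine sub_eq_zero.1 (hzero _ fun n => ?_)
    have h := hmain n (w n a + w n b) (a + b) (by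
      rw [map_add, add_sub_add_comm]; exact add_mem (hw n a) (hw n b))
    have h' := add_mem (hmain n _ _ (hw n a)) (hmain n _ _ (hw n b))
    have := sub_mem h h'
    rw [Finsupp.add_apply] at this
    convert this using 1
    ring
  · refine sub_eq_zero.1 (hzero _ fun n => ?_)
    have h := hmain n (r • w n a) (r • a) (by
      rw [map_smul, ← smul_sub]; exact Submodule.smul_mem _ _ (hw n a))
    have := sub_mem h (Ideal.mul_mem_left _ r (hmain n _ _ (hw n a)))
    rw [Finsupp.smul_apply] at this
    convert this using 1
    simp only [RingHom.id_apply, smul_eq_mul]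
    ring

variable [IsLocalRing R]

lemma exists_regular_system_of_parameters (R : Type*) [CommRing R] [IsRegularLocalRing R] :
    ∃ (d : ℕ) (x : Fin d → R), (d : WithBot ℕ∞) = ringKrullDim R ∧
      Ideal.span (Set.range x) = maximalIdeal R := by
  have hfg : (maximalIdeal R).FG := IsNoetherian.noetherian _
  have : Finite (maximalIdeal R).generators := Submodule.FG.finite_generators hfg
  let e := Finite.equivFinOfCardEq (Submodule.FG.generators_ncard hfg)
  refine ⟨_, fun i => (e.symm i : R), IsRegularLocalRing.spanFinrank_maximalIdeal, ?_⟩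
  rw [← Function.comp_def, e.symm.surjective.range_comp, Subtype.range_coe]
  exact Submodule.span_generators _

/-- A list of `dim R` elements of the maximal ideal is a system of parameters if the ideal it
generates contains powers of generators of the maximal ideal. -/
lemma isSystemOfParameters_of_radical {d : ℕ} {x : Fin d → R}
    (hd : (d : WithBot ℕ∞) = ringKrullDim R) (hx : Ideal.span (Set.range x) = maximalIdeal R)
    (rs : List R) (hlen : rs.length = d) (hle : Ideal.ofList rs ≤ maximalIdeal R)
    (hpow : ∀ i, ∃ n, x i ^ n ∈ Ideal.ofList rs) : IsSystemOfParameters R rs where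
  length_eq := by rw [hlen, hd]
  radical_eq := by
    refine le_antisymm ((maximalIdeal.isMaximal R).isPrime.radical_le_iff.2 hle) ?_
    rw [← hx, Ideal.span_le]
    rintro _ ⟨i, rfl⟩
    exact hpow i

/-- Listing `x i ^ (c + 1)` last among the powers gives a system of parameters; regularity of its
last entry is the claim. -/
lemma smul_mem_powIdealErase {d : ℕ} {x : Fin d → R}
    (hd : (d : WithBot ℕ∞) = ringKrullDim R) (hx : Ideal.span (Set.range x) = maximalIdeal R)
    (hM : ∀ rs : List R, IsSystemOfParameters R rs → RingTheory.Sequence.IsRegular M rs)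
    (e : Fin d → ℕ) (i : Fin d) (c : ℕ) (m : M)
    (hm : x i ^ (c + 1) • m ∈ powIdealErase x e i • (⊤ : Submodule R M)) :
    m ∈ powIdealErase x e i • (⊤ : Submodule R M) := by
  classical
  let l : List R := ((Finset.univ.erase i).toList).map fun j => x j ^ (e j + 1)
  have hl : Ideal.ofList l = powIdealErase x e i := by
    rw [Ideal.ofList, powIdealErase]
    congr 1
    ext r
    simp [l]
  have hxm : ∀ j, x j ∈ maximalIdeal R := fun j => hx ▸ Ideal.subset_span ⟨j, rfl⟩
  have hsop : IsSystemOfParameters R (l ++ [x i ^ (c + 1)]) := by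
    refine isSystemOfParameters_of_radical hd hx _ ?_ ?_ fun j => ?_
    · have : 0 < d := i.pos
      simp [l, Finset.card_erase_of_mem]
      omega
    · rw [Ideal.ofList_append, Ideal.ofList_singleton, hl, powIdealErase, sup_le_iff,
        Ideal.span_le, Ideal.span_singleton_le_iff_mem]
      refine ⟨?_, Ideal.pow_mem_of_mem _ (hxm i) _ (Nat.succ_pos _)⟩
      rintro _ ⟨j, -, rfl⟩
      exact Ideal.pow_mem_of_mem _ (hxm j) _ (Nat.succ_pos _)
    · rw [Ideal.ofList_append, Ideal.ofList_singleton, hl]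
      rcases eq_or_ne j i with rfl | hj
      · exact ⟨c + 1, Ideal.mem_sup_right (Ideal.mem_span_singleton_self _)⟩
      · exact ⟨e j + 1, Ideal.mem_sup_left (Ideal.subset_span ⟨j, hj, rfl⟩)⟩
  have hreg := (hM _ hsop).toIsWeaklyRegular
  rw [RingTheory.Sequence.isWeaklyRegular_append_iff,
    RingTheory.Sequence.isWeaklyRegular_singleton_iff, hl] at hreg
  rw [← Submodule.Quotient.mk_eq_zero] at hm ⊢
  exact hreg.2 (by simpa using hm)

/-- Modulo powers of the maximal ideal, membership in `J M` is detected by linear functionals. -/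
theorem mem_sup_pow_smul_top_of_forall_apply_mem {R M : Type*} [CommRing R] [AddCommGroup M]
    [Module R M] [IsRegularLocalRing R] [IsAdicComplete (maximalIdeal R) R]
    (hM : ∀ rs : List R, IsSystemOfParameters R rs → RingTheory.Sequence.IsRegular M rs)
    (J : Ideal R) (m : M) (hm : ∀ φ : M →ₗ[R] R, φ m ∈ J) (n : ℕ) :
    m ∈ (J ⊔ maximalIdeal R ^ n) • (⊤ : Submodule R M) := by
  obtain ⟨d, x, hd, hx⟩ := exists_regular_system_of_parameters R
  obtain ⟨κ, T, hsurj, hinj⟩ := exists_lift_basis (maximalIdeal R) M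
  have h0 : powIdeal x 0 = maximalIdeal R := by simp [powIdeal, hx]
  have hxm : ∀ j, x j ∈ maximalIdeal R := fun j => hx ▸ Ideal.subset_span ⟨j, rfl⟩
  have hinj' := powIdeal_reflects_smul_top x T
    (fun e i c m => smul_mem_powIdealErase hd hx hM e i c m) (h0 ▸ hinj)
  let Q : ℕ → Ideal R := fun k => powIdeal x fun _ => k
  have hQ : ∀ k, Q k ≤ maximalIdeal R ^ k := by
    intro k
    refine Ideal.span_le.2 ?_
    rintro _ ⟨i, rfl⟩
    exact Ideal.pow_le_pow_right k.le_succ (Ideal.pow_mem_pow (hxm i) _)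
  have hanti : Antitone Q := by
    intro a b hab
    refine Ideal.span_le.2 ?_
    rintro _ ⟨i, rfl⟩
    exact Ideal.mem_of_dvd _ (pow_dvd_pow _ (Nat.succ_le_succ hab)) (Ideal.subset_span ⟨i, rfl⟩)
  have hQsurj : ∀ k, LinearMap.range T ⊔ Q k • (⊤ : Submodule R M) = ⊤ := by
    intro k
    have hrad : maximalIdeal R ≤ (Q k).radical := by
      rw [← hx, Ideal.span_le]
      rintro _ ⟨i, rfl⟩
      exact ⟨k + 1, Ideal.subset_span ⟨i, rfl⟩⟩
    obtain ⟨N, hN⟩ := Ideal.exists_pow_le_of_le_radical_of_fg hrad (IsNoetherian.noetherian _)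
    exact top_le_iff.1 ((sup_pow_smul_top _ _ hsurj N).ge.trans
      (sup_le_sup_left (Submodule.smul_mono_left hN) _))
  obtain ⟨_, ⟨w, rfl⟩, z, hz, rfl⟩ := Submodule.mem_sup.1 (hQsurj n ▸ Submodule.mem_top : m ∈ _)
  refine add_mem (map_mem_smul_top T (mem_smul_top_of_apply_mem fun i => ?_))
    (Submodule.smul_mono_left ((hQ n).trans le_sup_right) hz)
  obtain ⟨φ, hφ⟩ := exists_coordinate (maximalIdeal R) T Q hanti hQ (fun k => hinj' _) hQsurj i
  have := hφ n w _ (by rwa [add_sub_cancel_left])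
  rw [← sub_sub_cancel (φ (T w + z)) (w i)]
  exact sub_mem (Ideal.mem_sup_left (hm φ)) (Ideal.mem_sup_right this)

end Coordinates

/-! ### Detecting membership in `J B` by functionals -/

section Detection

open IsLocalRing

variable {R B : Type*} [CommRing R] [CommRing B] [Algebra R B]

lemma mem_smul_top_iff_mem_map {J : Ideal R} {b : B} :
    b ∈ J • (⊤ : Submodule R B) ↔ b ∈ J.map (algebraMap R B) := by
  rw [Ideal.smul_top_eq_map, Submodule.restrictScalars_mem]

lemma apply_mem_of_mem_map (φ : B →ₗ[R] R) {J : Ideal R} {b : B}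
    (hb : b ∈ J.map (algebraMap R B)) : φ b ∈ J := by
  have := map_mem_smul_top φ (mem_smul_top_iff_mem_map.2 hb)
  rwa [smul_eq_mul, Ideal.mul_top] at this

lemma mem_map_of_isHausdorff [IsRegularLocalRing R] [IsAdicComplete (maximalIdeal R) R]
    (hB : IsBigCohenMacaulay R B) (J : Ideal R)
    (hsep : IsHausdorff (maximalIdeal R) (B ⧸ J.map (algebraMap R B)))
    {b : B} (hb : ∀ φ : B →ₗ[R] R, φ b ∈ J) : b ∈ J.map (algebraMap R B) := by
  rw [← Ideal.Quotient.eq_zero_iff_mem]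
  refine hsep.haus _ fun n => ?_
  rw [SModEq.zero]
  have h := mem_sup_pow_smul_top_of_forall_apply_mem hB J b hb n
  rw [Submodule.sup_smul, Submodule.mem_sup] at h
  obtain ⟨y, hy, z, hz, rfl⟩ := h
  rw [map_add, Ideal.Quotient.eq_zero_iff_mem.2 (mem_smul_top_iff_mem_map.1 hy), zero_add]
  exact map_mem_smul_top (Ideal.Quotient.mkₐ R (J.map (algebraMap R B))).toLinearMap hz

/-- Otherwise every `φ 1` lies in `m`, forcing `1 ∈ m B`. Such a `φ` brings membership of `r` in `I
B` back to `r ∈ I`. -/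
lemma IsBigCohenMacaulay.exists_isUnit_apply_one [IsRegularLocalRing R]
    [IsAdicComplete (maximalIdeal R) R] (hB : IsBigCohenMacaulay R B) :
    ∃ φ : B →ₗ[R] R, IsUnit (φ 1) := by
  by_contra! h
  obtain ⟨d, x, hd, hx⟩ := exists_regular_system_of_parameters R
  have hl : Ideal.ofList (List.ofFn x) = maximalIdeal R := by
    rw [← hx, Ideal.ofList]
    congr 1
    ext
    simp
  have hreg := hB (List.ofFn x) (isSystemOfParameters_of_radical hd hx _ (by simp) hl.le fun i =>
    ⟨1, by rw [hl, pow_one, ← hx]; exact Ideal.subset_span ⟨i, rfl⟩⟩)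
  refine hreg.top_ne_smul ?_
  have h1 := mem_sup_pow_smul_top_of_forall_apply_mem hB (maximalIdeal R) 1
    (fun φ => (mem_maximalIdeal _).2 (h φ)) 1
  rw [pow_one, sup_idem, mem_smul_top_iff_mem_map, ← Ideal.eq_top_iff_one] at h1
  rw [hl, Ideal.smul_top_eq_map, h1]
  rfl

/-- The Frobenius power `J ^ [p ^ e]` contains the `p ^ e`-th powers of elements of `J B`. -/
lemma pow_mem_map_iterateFrobenius (p e : ℕ) [ExpChar R p] [ExpChar B p] {J : Ideal R} {b : B}
    (hb : b ∈ J.map (algebraMap R B)) :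
    b ^ p ^ e ∈ (J.map (iterateFrobenius R p e)).map (algebraMap R B) := by
  have h := Ideal.mem_map_of_mem (iterateFrobenius B p e) hb
  rw [Ideal.map_map] at h ⊢
  rwa [← RingHom.iterateFrobenius_comm] at h

/-- Krull's intersection theorem for `R / I`. -/
lemma mem_of_forall_mem_sup_pow [IsLocalRing R] [IsNoetherianRing R] {I : Ideal R} {r : R}
    (h : ∀ n, r ∈ I ⊔ maximalIdeal R ^ n) : r ∈ I := by
  rw [← Ideal.Quotient.eq_zero_iff_mem]
  refine IsHausdorff.haus (inferInstance : IsHausdorff (maximalIdeal R) (R ⧸ I)) _ fun n => ?_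
  rw [SModEq.zero]
  obtain ⟨y, hy, z, hz, rfl⟩ := Submodule.mem_sup.1 (h n)
  rw [map_add, Ideal.Quotient.eq_zero_iff_mem.2 hy, zero_add]
  refine map_mem_smul_top (Ideal.Quotient.mkₐ R I).toLinearMap ?_
  rwa [smul_eq_mul, Ideal.mul_top]

/-- Frobenius moves the approximation `b ∈ (J + m ^ n) B` to the element `r` of `R`, where Krull's
theorem replaces separatedness of `B / J B`. -/
lemma mem_map_iterateFrobenius_of_forall_apply_mem [IsRegularLocalRing R]
    [IsAdicComplete (maximalIdeal R) R] (hB : IsBigCohenMacaulay R B) (p e : ℕ)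
    [ExpChar R p] [ExpChar B p] {J : Ideal R} {b : B} {r : R}
    (hr : b ^ p ^ e = algebraMap R B r) (hb : ∀ φ : B →ₗ[R] R, φ b ∈ J) :
    r ∈ J.map (iterateFrobenius R p e) := by
  obtain ⟨φ, hφ⟩ := hB.exists_isUnit_apply_one
  refine mem_of_forall_mem_sup_pow fun n => ?_
  have h := mem_smul_top_iff_mem_map.1 (mem_sup_pow_smul_top_of_forall_apply_mem hB J b hb n)
  have h1 := apply_mem_of_mem_map φ (pow_mem_map_iterateFrobenius p e h)
  rw [hr, Algebra.algebraMap_eq_smul_one, map_smul, smul_eq_mul,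
    Ideal.mul_unit_mem_iff_mem _ hφ, Ideal.map_sup] at h1
  refine (show _ ≤ J.map (iterateFrobenius R p e) ⊔ maximalIdeal R ^ n from sup_le_sup_left ?_ _) h1
  rw [Ideal.map_le_iff_le_comap]
  intro y hy
  rw [Ideal.mem_comap, iterateFrobenius_def]
  exact Ideal.pow_mem_of_mem _ hy _ (expChar_pow_pos R p e)

/-- Over a domain containing all `p ^ e`-th roots of elements of `R`, an element whose
`p ^ e`-th power lies in the Frobenius power `J ^ [p ^ e]` of `J` lies in the extension of `J`. -/
lemma mem_map_of_mem_map_iterateFrobenius {S : Type*} [CommRing S] [IsDomain S] [Algebra R S]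
    (p e : ℕ) [ExpChar R p] [ExpChar S p]
    (hroot : ∀ r : R, ∃ s : S, s ^ p ^ e = algebraMap R S r) {J : Ideal R} {s : S} {r : R}
    (hs : s ^ p ^ e = algebraMap R S r) (hr : r ∈ J.map (iterateFrobenius R p e)) :
    s ∈ J.map (algebraMap R S) := by
  -- Frobenius is injective on the domain `S`, so any `p ^ e`-th root of `r` is `s`.
  suffices h : ∃ s' ∈ J.map (algebraMap R S), s' ^ p ^ e = algebraMap R S r by
    obtain ⟨s', hs', h⟩ := h
    rwa [iterateFrobenius_inj S p e (hs.trans h.symm)]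
  clear hs
  refine Submodule.span_induction ?_ ⟨0, zero_mem _, ?_⟩ ?_ ?_ hr
  · rintro _ ⟨j, hj, rfl⟩
    exact ⟨_, Ideal.mem_map_of_mem _ hj, by simp [iterateFrobenius_def]⟩
  · rw [map_zero, zero_pow (expChar_pow_pos S p e).ne']
  · rintro x y - - ⟨s₁, h₁, e₁⟩ ⟨s₂, h₂, e₂⟩
    exact ⟨s₁ + s₂, add_mem h₁ h₂, by rw [add_pow_expChar_pow, e₁, e₂, map_add]⟩
  · rintro a x - ⟨s₁, h₁, e₁⟩
    obtain ⟨u, hu⟩ := hroot a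
    exact ⟨u * s₁, Ideal.mul_mem_left _ _ h₁, by rw [mul_pow, hu, e₁, smul_eq_mul, map_mul]⟩

end Detection

/-! ### Roots and divisibility in `R⁺` -/

section AbsIntegralClosure

variable {R K : Type*} [CommRing R] [Field K] [Algebra R K] [FaithfulSMul R K] [IsAlgClosed K]
    [Algebra.IsAlgebraic R K]

lemma AbsIntegralClosure.exists_pow_eq (r : R) {n : ℕ} (hn : 0 < n) :
    ∃ s : AbsIntegralClosure R K, s ^ n = algebraMap R (AbsIntegralClosure R K) r := by
  obtain ⟨z, hz⟩ := IsAlgClosed.exists_pow_nat_eq (algebraMap R K r) hn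
  exact ⟨⟨z, IsIntegral.of_pow hn (hz ▸ isIntegral_algebraMap)⟩, Subtype.ext hz⟩

/-- The quotient `g / h` has an integral `n`-th power, so it is itself integral. -/
lemma AbsIntegralClosure.dvd_of_pow_dvd_pow {g h : AbsIntegralClosure R K} {n : ℕ} (hn : 0 < n)
    (hgh : h ^ n ∣ g ^ n) : h ∣ g := by
  obtain ⟨c, hc⟩ := hgh
  rcases eq_or_ne h 0 with rfl | hh
  · rw [zero_pow hn.ne', zero_mul] at hc
    rw [eq_zero_of_pow_eq_zero hc]
  have hh' : (h : K) ≠ 0 := fun h0 => hh (Subtype.ext h0)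
  have hcK : (g : K) ^ n = (h : K) ^ n * c := congrArg Subtype.val hc
  have hint : IsIntegral R ((g : K) / h) := by
    refine IsIntegral.of_pow hn ?_
    rw [div_pow, hcK, mul_div_cancel_left₀ _ (pow_ne_zero _ hh')]
    exact c.2
  exact ⟨⟨_, hint⟩, Subtype.ext (mul_div_cancel₀ (g : K) hh').symm⟩

/-- Every element of `(f R⁺)^{> t}` is a multiple of some `f ^ (a / p ^ e)` with
`a / p ^ e > t`. -/
lemma exists_dvd_of_mem_powGT {f : R} {t : ℝ≥0} {g : AbsIntegralClosure R K}
    (hg : g ∈ powGT (AbsIntegralClosure R K) f t) {p : ℕ} (hp : 1 < p) :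
    ∃ (a e : ℕ) (h : AbsIntegralClosure R K),
      h ^ p ^ e = algebraMap R (AbsIntegralClosure R K) (f ^ a) ∧
      h ∈ powGT (AbsIntegralClosure R K) f t ∧ h ∣ g := by
  obtain ⟨m, n, hn, htm, hmem⟩ := hg
  -- The interval from `t` to `m / n`, scaled by `p ^ e`, gets length above one, so rounding `m / n`
  -- down to denominator `p ^ e` stays above `t`.
  obtain ⟨e, he⟩ : ∃ e : ℕ, 1 < (m / n - t : ℝ) * (p : ℝ) ^ e := by
    have hpos : 0 < (m / n - t : ℝ) := sub_pos.2 (by exact_mod_cast htm)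
    obtain ⟨e, he⟩ := pow_unbounded_of_one_lt (1 / (m / n - t : ℝ))
      (by exact_mod_cast hp : (1 : ℝ) < p)
    exact ⟨e, by rwa [div_lt_iff₀' hpos] at he⟩
  have hq : 0 < p ^ e := pow_pos (by omega) e
  have hqR : (0 : ℝ) < (p : ℝ) ^ e := by exact_mod_cast hq
  have hnR : (0 : ℝ) < n := by exact_mod_cast hn
  let a := ⌊(m / n : ℝ) * (p : ℝ) ^ e⌋₊
  have ha1 : (a : ℝ) ≤ (m / n : ℝ) * (p : ℝ) ^ e := Nat.floor_le (by positivity)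
  have ha2 : (m / n : ℝ) * (p : ℝ) ^ e < a + 1 := Nat.lt_floor_add_one _
  have hlt : (t : ℝ) < a / (p : ℝ) ^ e := by
    rw [lt_div_iff₀ hqR]
    linarith [sub_mul (m / n : ℝ) t ((p : ℝ) ^ e)]
  have hle : a * n ≤ m * p ^ e := by
    rw [div_mul_eq_mul_div, le_div_iff₀ hnR] at ha1
    exact_mod_cast ha1
  obtain ⟨h, hh⟩ := AbsIntegralClosure.exists_pow_eq (K := K) (f ^ a) hq
  refine ⟨a, e, h, hh, ⟨a, p ^ e, hq, ?_, ?_⟩, ?_⟩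
  · rw [← NNReal.coe_lt_coe]
    simpa using hlt
  · rw [hh, map_pow]
    exact Ideal.mem_span_singleton_self _
  -- Compare `p ^ e * n`-th powers: `f ^ (a * n)` divides `f ^ (m * p ^ e)`, which divides `g ^ (n *
  -- p ^ e)`.
  · refine AbsIntegralClosure.dvd_of_pow_dvd_pow (mul_pos hq hn) ?_
    rw [pow_mul, hh, mul_comm, pow_mul, map_pow, ← pow_mul]
    refine (pow_dvd_pow _ hle).trans ?_
    rw [pow_mul]
    exact pow_dvd_pow_of_dvd (Ideal.mem_span_singleton.1 hmem) _

end AbsIntegralClosure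

/-! ### Thresholds and jumping numbers -/

section Order

variable {R S B : Type*} [CommRing R] [CommRing S] [CommRing B] [Algebra R S] [Algebra R B]
  [Algebra S B]

lemma powGT_anti (f : R) {s t : ℝ≥0} (hst : s ≤ t) : powGT S f t ⊆ powGT S f s := by
  rintro g ⟨m, n, hn, ht, hg⟩
  exact ⟨m, n, hn, hst.trans_lt ht, hg⟩

lemma testIdeal_anti (f : R) {s t : ℝ≥0} (hst : s ≤ t) :
    testIdeal S B f t ≤ testIdeal S B f s := by
  refine Ideal.span_mono ?_
  rintro r ⟨x, hx, φ, rfl⟩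
  exact ⟨x, Ideal.span_mono (Set.image_mono (powGT_anti f hst)) hx, φ, rfl⟩

/-- The infimum defining the threshold is attained. -/
lemma mem_map_of_mem_powGT_of_threshold_le {J : Ideal R} {f : R} {t : ℝ≥0}
    (ht : threshold S B J f ≤ t) {g : S} (hg : g ∈ powGT S f t) :
    algebraMap S B g ∈ J.map (algebraMap R B) := by
  obtain ⟨m, n, hn, htm, hmem⟩ := hg
  -- The strict inequality `t < m / n` leaves room for an admissible `s < m / n`; the same `m`, `n`
  -- put `g` in `powGT S f s`.
  obtain ⟨_, ⟨s, hs, rfl⟩, hsm⟩ := sInf_lt_iff.1 (ht.trans_lt (ENNReal.coe_lt_coe.2 htm))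
  exact hs g ⟨m, n, hn, ENNReal.coe_lt_coe.1 hsm, hmem⟩

lemma threshold_le {J : Ideal R} {f : R} {t : ℝ≥0}
    (ht : ∀ g ∈ powGT S f t, algebraMap S B g ∈ J.map (algebraMap R B)) :
    threshold S B J f ≤ t :=
  sInf_le ⟨t, ht, rfl⟩

lemma testIdeal_le_of_forall_mem_map {J : Ideal R} {f : R} {t : ℝ≥0}
    (h : ∀ g ∈ powGT S f t, algebraMap S B g ∈ J.map (algebraMap R B)) :
    testIdeal S B f t ≤ J := by
  refine Ideal.span_le.2 ?_
  rintro _ ⟨x, hx, φ, rfl⟩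
  refine apply_mem_of_mem_map φ (Ideal.span_le.2 ?_ hx)
  rintro _ ⟨g, hg, rfl⟩
  exact h g hg

lemma apply_mem_testIdeal {f : R} {t : ℝ≥0} {g : S} (hg : g ∈ powGT S f t) (φ : B →ₗ[R] R) :
    φ (algebraMap S B g) ∈ testIdeal S B f t :=
  Ideal.subset_span ⟨_, Ideal.subset_span ⟨g, hg, rfl⟩, φ, rfl⟩

/-- If `τ_B(f ^ t)` is the smallest ideal `J` with `(f S)^{> t} ⊆ J B` for all `t`, then the jumping
numbers are the finite thresholds. -/
lemma isJumpingNumber_iff_exists_threshold_eq {f : R}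
    (h : ∀ (t : ℝ≥0) (g : S), g ∈ powGT S f t →
      algebraMap S B g ∈ (testIdeal S B f t).map (algebraMap R B)) (α : ℝ≥0) :
    IsJumpingNumber S B f α ↔ ∃ J : Ideal R, threshold S B J f = α := by
  have key : ∀ (J : Ideal R) (t : ℝ≥0), threshold S B J f ≤ t ↔ testIdeal S B f t ≤ J :=
    fun J t => ⟨fun ht => testIdeal_le_of_forall_mem_map fun g hg =>
      mem_map_of_mem_powGT_of_threshold_le ht hg, fun ht => threshold_le fun g hg =>
        Ideal.map_mono ht (h t g hg)⟩
  constructor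
  -- A threshold of `τ_B(f ^ α)` below `α` would make the test ideal constant on some `[s, α]` with
  -- `s < α`.
  · refine fun hα => ⟨testIdeal S B f α, ((key _ _).2 le_rfl).antisymm ?_⟩
    by_contra! hlt
    obtain ⟨s, hs, hsα⟩ := ENNReal.lt_iff_exists_nnreal_btwn.1 hlt
    rw [ENNReal.coe_lt_coe] at hsα
    refine hα (α - s) (tsub_pos_of_lt hsα) tsub_le_self ?_
    rw [tsub_tsub_cancel_of_le hsα.le]
    exact (testIdeal_anti f hsα.le).antisymm ((key _ _).1 hs.le)
  · rintro ⟨J, hJ⟩ ε hε hεα heq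
    have h1 := (key J (α - ε)).2 (heq ▸ (key J α).1 hJ.le)
    rw [hJ, ENNReal.coe_le_coe] at h1
    exact (tsub_lt_self (hε.trans_le hεα) hε).not_ge h1

end Order

/-! ### The prime characteristic case -/

section MainResult

open IsLocalRing

variable {R K B : Type*} [CommRing R] [IsRegularLocalRing R] [IsAdicComplete (maximalIdeal R) R]
  [Field K] [Algebra R K] [FaithfulSMul R K] [IsAlgClosed K] [Algebra.IsAlgebraic R K] [CommRing B]
  [Algebra R B] [Algebra (AbsIntegralClosure R K) B] [IsScalarTower R (AbsIntegralClosure R K) B]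

lemma map_mem_map_testIdeal_of_charP (hB : IsBigCohenMacaulay R B) (p : ℕ) [Fact p.Prime]
    [CharP R p] {f : R} {t : ℝ≥0} {g : AbsIntegralClosure R K}
    (hg : g ∈ powGT (AbsIntegralClosure R K) f t) :
    algebraMap (AbsIntegralClosure R K) B g ∈
      (testIdeal (AbsIntegralClosure R K) B f t).map (algebraMap R B) := by
  have : Nontrivial B := by
    obtain ⟨φ, hφ⟩ := hB.exists_isUnit_apply_one
    by_contra hn
    rw [not_nontrivial_iff_subsingleton] at hn
    rw [Subsingleton.elim (1 : B) 0, map_zero] at hφ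
    exact not_isUnit_zero hφ
  have : CharP K p := charP_of_injective_algebraMap (FaithfulSMul.algebraMap_injective R K) p
  have : CharP (AbsIntegralClosure R K) p :=
    (RingHom.charP_iff (algebraMap (AbsIntegralClosure R K) K) Subtype.val_injective p).2 this
  have : CharP B p := (CharP.charP_iff_prime_eq_zero Fact.out).2 (by
    rw [← map_natCast (algebraMap R B), CharP.cast_eq_zero, map_zero])
  obtain ⟨a, e, h, hpow, hmem, hdvd⟩ := exists_dvd_of_mem_powGT hg (Fact.out : p.Prime).one_lt
  have hJ := mem_map_iterateFrobenius_of_forall_apply_mem hB p e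
    (b := algebraMap (AbsIntegralClosure R K) B h) (r := f ^ a)
    (by rw [← map_pow, hpow, ← IsScalarTower.algebraMap_apply]) (apply_mem_testIdeal hmem)
  have hS := mem_map_of_mem_map_iterateFrobenius p e
    (fun r => AbsIntegralClosure.exists_pow_eq r (expChar_pow_pos R p e)) hpow hJ
  have := Ideal.mem_map_of_mem (algebraMap (AbsIntegralClosure R K) B)
    (Ideal.mem_of_dvd _ hdvd hS)
  rwa [Ideal.map_map, ← IsScalarTower.algebraMap_eq] at this

end MainResult

end BCM

theorem mainTheorem1
    (R : Type*) [CommRing R] [IsRegularLocalRing R]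
    [IsAdicComplete (IsLocalRing.maximalIdeal R) R]
    (K : Type*) [Field K] [Algebra R K] [FaithfulSMul R K] [IsAlgClosed K]
    [Algebra.IsAlgebraic R K]
    (B : Type*) [CommRing B] [Algebra R B] [Algebra (BCM.AbsIntegralClosure R K) B]
    [IsScalarTower R (BCM.AbsIntegralClosure R K) B]
    (hB : BCM.IsBigCohenMacaulay R B)
    (hsep : (∃ p : ℕ, p.Prime ∧ CharP R p) ∨
      ∀ J : Ideal R, IsHausdorff (IsLocalRing.maximalIdeal R) (B ⧸ J.map (algebraMap R B)))
    (f : R) :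
    {α : ℝ≥0 | BCM.IsJumpingNumber (BCM.AbsIntegralClosure R K) B f α} =
      {α : ℝ≥0 | ∃ J : Ideal R, BCM.threshold (BCM.AbsIntegralClosure R K) B J f = (α : ℝ≥0∞)} := by
  ext α
  refine BCM.isJumpingNumber_iff_exists_threshold_eq (fun t g hg => ?_) α
  rcases hsep with ⟨p, hp, hchar⟩ | hsep
  · have : Fact p.Prime := ⟨hp⟩
    exact BCM.map_mem_map_testIdeal_of_charP hB p hg
  · exact BCM.mem_map_of_isHausdorff hB _ (hsep _) (BCM.apply_mem_testIdeal hg)
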